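/- Let $E$ and $F$ be real Banach lattices such that the norms of the dual Banach lattice $E^*$ and of $F$ are order continuous (a norm is order continuous if $\|x_\alpha\|\to 0$ for every net $x_\alpha\downarrow 0$). All operators are linear and bounded; $B$ denotes a closed unit ball; a sequence $(x_n)$ in a Banach lattice is disjoint if $|x_m|\wedge|x_n|=0$ for $m\neq n$. A bounded subset $A$ of $F$ is called - an Lwc set, if every disjoint sequence in its solid hull $\bigcup_{a\in A}[-|a|,|a|]$ is norm null; - almost limited, if every disjoint weak$^*$-null sequence $(f_n)$ in $F^*$ converges to $0$ uniformly on $A$; - almost order bounded, if for every $\varepsilon>0$ there are $a,b\in F$ with $A\subseteq[a,b]+\varepsilon B_F$. An operator $T:E\to F$ is called - M-weakly compact (Mwc), if $\|Tx_n\|\to 0$ for every disjoint bounded sequence $(x_n)$ in $E$; - almost L-weakly compact (aLwc), if $T$ maps relatively weakly compact sets to Lwc sets; - order L-weakly compact (oLwc), if $T$ maps order bounded sets to Lwc sets; - Dunford--Pettis, if $\|Tx_n\|\to 0$ for every weakly null sequence $(x_n)$ in $E$; - almost limited, if $T(B_E)$ is almost limited; - semi-compact, if $T$ maps bounded sets to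 almost order bounded sets. Then the following hold. (i) Every positive aLwc operator $T:E\to F$ is Mwc. (ii) Every positive Dunford--Pettis operator $T:E\to F$ is Mwc, and every positive almost limited operator $T:E\to F$ is Mwc. (iii) If the lattice operations of $F$ are weakly sequentially continuous (that is, $x_n\to 0$ weakly in $F$ implies $|x_n|\to 0$ weakly), then every aLwc operator $T:E\to F$ is Mwc. (iv) If $E$ has the Schur property (every weakly null sequence in $E$ is norm null), then every oLwc operator $T:E\to F$ is semi-compact. -/

import Mathlib

open Set Filter Topology
open scoped Pointwise

noncomputable section

namespace BanachLattice

/-! ## The dual Banach lattice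

A Banach lattice `E` is given by Mathlib's classes `NormedAddCommGroup`, `NormedSpace ℝ`,
`CompleteSpace`, `Lattice`, `IsOrderedAddMonoid`, `IsOrderedModule ℝ`, `HasSolidNorm`.
Its norm dual `StrongDual ℝ E` is ordered by `f ≤ g ↔ ∀ x ≥ 0, f x ≤ g x`; the lattice operations
are given by the Riesz-Kantorovich formulas. -/

section Dual

variable {E : Type*} [NormedAddCommGroup E] [NormedSpace ℝ E] [Lattice E]
  [IsOrderedAddMonoid E] [HasSolidNorm E]

lemma norm_le_of_mem_Icc {x y : E} (hy : y ∈ Icc 0 x) : ‖y‖ ≤ ‖x‖ :=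
  norm_le_norm_of_abs_le_abs
    (by rw [abs_of_nonneg hy.1, abs_of_nonneg (hy.1.trans hy.2)]; exact hy.2)

/-- `x ↦ sup {f y | 0 ≤ y ≤ x}`, of interest for `x ≥ 0`. -/
def posSup (f : StrongDual ℝ E) (x : E) : ℝ := sSup (f '' Icc 0 x)

lemma apply_le_of_mem_Icc (f : StrongDual ℝ E) {x y : E} (hy : y ∈ Icc 0 x) :
    f y ≤ ‖f‖ * ‖x‖ :=
  (le_abs_self _).trans <| (f.le_opNorm y).trans <|
    mul_le_mul_of_nonneg_left (norm_le_of_mem_Icc hy) (norm_nonneg f)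

lemma bddAbove_image_Icc (f : StrongDual ℝ E) (x : E) : BddAbove (f '' Icc 0 x) := by
  refine ⟨‖f‖ * ‖x‖, ?_⟩
  rintro _ ⟨y, hy, rfl⟩
  exact apply_le_of_mem_Icc f hy

lemma le_posSup (f : StrongDual ℝ E) {x y : E} (hy : y ∈ Icc 0 x) : f y ≤ posSup f x :=
  le_csSup (bddAbove_image_Icc f x) ⟨y, hy, rfl⟩

lemma posSup_le (f : StrongDual ℝ E) {x : E} (hx : 0 ≤ x) {c : ℝ}
    (h : ∀ y ∈ Icc 0 x, f y ≤ c) : posSup f x ≤ c := by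
  refine csSup_le ⟨f 0, 0, ⟨le_rfl, hx⟩, rfl⟩ ?_
  rintro _ ⟨y, hy, rfl⟩
  exact h y hy

lemma posSup_nonneg (f : StrongDual ℝ E) {x : E} (hx : 0 ≤ x) : 0 ≤ posSup f x := by
  simpa using le_posSup f (y := 0) ⟨le_rfl, hx⟩

lemma posSup_add (f : StrongDual ℝ E) {x y : E} (hx : 0 ≤ x) (hy : 0 ≤ y) :
    posSup f (x + y) = posSup f x + posSup f y := by
  apply le_antisymm
  · refine posSup_le f (add_nonneg hx hy) fun z hz => ?_
    have h1 : z ⊓ x ∈ Icc 0 x := ⟨le_inf hz.1 hx, inf_le_right⟩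
    have h2 : z - z ⊓ x ∈ Icc 0 y := by
      refine ⟨sub_nonneg.2 inf_le_left, ?_⟩
      rw [sub_le_iff_le_add, ← sub_le_iff_le_add']
      exact le_inf (sub_le_self _ hy) (sub_le_iff_le_add.2 hz.2)
    have := add_le_add (le_posSup f h1) (le_posSup f h2)
    rwa [← map_add, add_sub_cancel] at this
  · rw [← le_sub_iff_add_le]
    refine posSup_le f hx fun u hu => ?_
    rw [le_sub_comm]
    refine posSup_le f hy fun v hv => ?_
    rw [le_sub_iff_add_le, add_comm, ← map_add]
    exact le_posSup f ⟨add_nonneg hu.1 hv.1, add_le_add hu.2 hv.2⟩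

lemma posSup_sub_posSup_eq (f : StrongDual ℝ E) {a b c d : E} (ha : 0 ≤ a) (hb : 0 ≤ b)
    (hc : 0 ≤ c) (hd : 0 ≤ d) (h : a - b = c - d) :
    posSup f a - posSup f b = posSup f c - posSup f d := by
  have h' : a + d = c + b := by rwa [sub_eq_sub_iff_add_eq_add] at h
  have := congrArg (posSup f) h'
  rw [posSup_add f ha hd, posSup_add f hc hb] at this
  linarith

/-- The additive extension of `posSup f` from the positive cone to all of `E`. -/
def posAddHom (f : StrongDual ℝ E) : E →+ ℝ :=
  AddMonoidHom.mk' (fun x => posSup f x⁺ - posSup f x⁻) fun x y => by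
    have h := posSup_sub_posSup_eq f (posPart_nonneg (x + y)) (negPart_nonneg (x + y))
      (add_nonneg (posPart_nonneg x) (posPart_nonneg y))
      (add_nonneg (negPart_nonneg x) (negPart_nonneg y)) (by
        rw [posPart_sub_negPart, add_sub_add_comm, posPart_sub_negPart, posPart_sub_negPart])
    rw [posSup_add f (posPart_nonneg x) (posPart_nonneg y),
      posSup_add f (negPart_nonneg x) (negPart_nonneg y)] at h
    rw [h]
    ring

lemma posAddHom_bound (f : StrongDual ℝ E) (x : E) : ‖posAddHom f x‖ ≤ ‖f‖ * ‖x‖ := by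
  have key : ∀ z : E, 0 ≤ z → z ≤ |x| → posSup f z ≤ ‖f‖ * ‖x‖ := fun z hz hzx =>
    posSup_le f hz fun y hy =>
      (apply_le_of_mem_Icc f (x := |x|) ⟨hy.1, hy.2.trans hzx⟩).trans_eq (by rw [norm_abs_eq_norm])
  have hp := key x⁺ (posPart_nonneg x) (sup_le (le_abs_self x) (abs_nonneg x))
  have hn := key x⁻ (negPart_nonneg x) (sup_le (neg_le_abs x) (abs_nonneg x))
  have hp0 := posSup_nonneg f (posPart_nonneg x)
  have hn0 := posSup_nonneg f (negPart_nonneg x)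
  rw [Real.norm_eq_abs, abs_le]
  change _ ≤ posSup f x⁺ - posSup f x⁻ ∧ posSup f x⁺ - posSup f x⁻ ≤ _
  constructor <;> linarith

/-- The positive part `f ∨ 0` of a functional `f` in the dual. -/
def dualPos (f : StrongDual ℝ E) : StrongDual ℝ E :=
  (posAddHom f).toRealLinearMap
    (AddMonoidHomClass.continuous_of_bound (posAddHom f) ‖f‖ (posAddHom_bound f))

lemma dualPos_apply (f : StrongDual ℝ E) {x : E} (hx : 0 ≤ x) :
    dualPos f x = sSup (f '' Icc 0 x) := by
  change posSup f x⁺ - posSup f x⁻ = posSup f x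
  have h0 : posSup f (0 : E) = 0 := by simp [posSup]
  rw [posPart_of_nonneg hx, negPart_of_nonneg hx, h0, sub_zero]

/-- The order of the dual: `f ≤ g` iff `f x ≤ g x` for all `x ≥ 0`. -/
instance dualPartialOrder : PartialOrder (StrongDual ℝ E) where
  le f g := ∀ x : E, 0 ≤ x → f x ≤ g x
  le_refl _ _ _ := le_rfl
  le_trans _ _ _ h₁ h₂ x hx := (h₁ x hx).trans (h₂ x hx)
  le_antisymm f g h₁ h₂ := by
    ext x
    have hp := le_antisymm (h₁ _ (posPart_nonneg x)) (h₂ _ (posPart_nonneg x))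
    have hn := le_antisymm (h₁ _ (negPart_nonneg x)) (h₂ _ (negPart_nonneg x))
    rw [← posPart_sub_negPart x, map_sub, map_sub, hp, hn]

lemma dual_le_def {f g : StrongDual ℝ E} : f ≤ g ↔ ∀ x : E, 0 ≤ x → f x ≤ g x := Iff.rfl

lemma dualPos_nonneg (f : StrongDual ℝ E) : 0 ≤ dualPos f := fun x hx => by
  rw [dualPos_apply f hx]
  exact posSup_nonneg f hx

lemma le_dualPos (f : StrongDual ℝ E) : f ≤ dualPos f := fun x hx => by
  rw [dualPos_apply f hx]
  exact le_posSup f ⟨hx, le_rfl⟩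

lemma dualPos_le {f g : StrongDual ℝ E} (hg : 0 ≤ g) (hfg : f ≤ g) : dualPos f ≤ g :=
  fun x hx => by
    rw [dualPos_apply f hx]
    refine posSup_le f hx fun y hy => (hfg y hy.1).trans ?_
    have := hg (x - y) (sub_nonneg.2 hy.2)
    rw [map_sub] at this
    simpa using this

instance dualIsOrderedAddMonoid : IsOrderedAddMonoid (StrongDual ℝ E) where
  add_le_add_left _ _ h c := fun x hx => by simpa using h x hx

/-- The dual of a Banach lattice is a vector lattice, with `f ⊔ g = g + (f - g)⁺` and
`f ⊓ g = f - (f - g)⁺`. -/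
instance dualLattice : Lattice (StrongDual ℝ E) where
  sup f g := g + dualPos (f - g)
  le_sup_left f g := sub_le_iff_le_add'.1 (le_dualPos (f - g))
  le_sup_right f g := le_add_of_nonneg_right (dualPos_nonneg (f - g))
  sup_le f g h hf hg := by
    rw [← le_sub_iff_add_le']
    exact dualPos_le (sub_nonneg.2 hg) (sub_le_sub_right hf g)
  inf f g := f - dualPos (f - g)
  inf_le_left f g := sub_le_self _ (dualPos_nonneg (f - g))
  inf_le_right f g := by
    rw [sub_le_comm]
    exact le_dualPos (f - g)
  le_inf h f g hf hg := by
    rw [le_sub_comm]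
    exact dualPos_le (sub_nonneg.2 hf) (sub_le_sub_left hg f)

instance dualIsOrderedModule : IsOrderedModule ℝ (StrongDual ℝ E) where
  smul_le_smul_of_nonneg_left c hc f g hfg := fun x hx => by
    simpa using mul_le_mul_of_nonneg_left (hfg x hx) hc
  smul_le_smul_of_nonneg_right f hf c d hcd := fun x hx => by
    simpa using mul_le_mul_of_nonneg_right hcd (by simpa using hf x hx)

lemma abs_apply_le_abs (f : StrongDual ℝ E) (x : E) : |f x| ≤ |f| |x| := by
  have h₁ := le_abs_self f _ (posPart_nonneg x)
  have h₂ := le_abs_self f _ (negPart_nonneg x)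
  have h₃ := neg_le_abs f _ (posPart_nonneg x)
  have h₄ := neg_le_abs f _ (negPart_nonneg x)
  rw [neg_apply] at h₃ h₄
  have hx : f x = f x⁺ - f x⁻ := by rw [← map_sub, posPart_sub_negPart]
  have hax : |f| |x| = |f| x⁺ + |f| x⁻ := by rw [← map_add, posPart_add_negPart]
  rw [hx, hax, abs_le]
  constructor <;> linarith

lemma abs_dual_apply_le (f : StrongDual ℝ E) {x : E} (hx : 0 ≤ x) : |f| x ≤ ‖f‖ * ‖x‖ := by
  change (-f + dualPos (f - -f)) x ≤ _
  rw [add_apply, dualPos_apply _ hx, neg_apply,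
    ← le_neg_add_iff_add_le, neg_neg]
  refine posSup_le _ hx fun y hy => ?_
  have h : f (y + y - x) ≤ ‖f‖ * ‖x‖ := by
    refine (le_abs_self _).trans ((f.le_opNorm _).trans ?_)
    refine mul_le_mul_of_nonneg_left (norm_le_norm_of_abs_le_abs ?_) (norm_nonneg f)
    rw [abs_of_nonneg hx]
    refine sup_le ?_ ?_
    · rw [sub_le_iff_le_add]
      exact add_le_add hy.2 hy.2
    · rw [neg_sub, sub_le_self_iff]
      exact add_nonneg hy.1 hy.1
  rw [map_sub, map_add] at h
  simp only [sub_neg_eq_add, add_apply]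
  linarith

instance dualHasSolidNorm : HasSolidNorm (StrongDual ℝ E) where
  solid f g h := by
    refine f.opNorm_le_bound (norm_nonneg g) fun x => ?_
    calc ‖f x‖ ≤ |f| |x| := abs_apply_le_abs f x
      _ ≤ |g| |x| := h _ (abs_nonneg x)
      _ ≤ ‖g‖ * ‖|x|‖ := abs_dual_apply_le g (abs_nonneg x)
      _ = ‖g‖ * ‖x‖ := by rw [norm_abs_eq_norm]

end Dual

/-! ## Sequences and sets -/

/-- The norm of a normed lattice is order continuous: `‖x_α‖ → 0` for every net `x_α ↓ 0`.
Such a net enters only through its range, a downward directed set with infimum `0`; along the net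
the norms decrease. -/
def HasOrderContinuousNorm (E : Type*) [NormedAddCommGroup E] [Lattice E] : Prop :=
  ∀ D : Set E, D.Nonempty → DirectedOn (· ≥ ·) D → IsGLB D 0 → ∀ ε > (0 : ℝ), ∃ x ∈ D, ‖x‖ < ε

/-- A disjoint sequence: `|x_m| ∧ |x_n| = 0` for `m ≠ n`. -/
def IsDisjointSeq {E : Type*} [AddCommGroup E] [Lattice E] (x : ℕ → E) : Prop :=
  ∀ m n, m ≠ n → |x m| ⊓ |x n| = 0

/-- A weakly null sequence of a normed space. -/
def IsWeaklyNull {X : Type*} [NormedAddCommGroup X] [NormedSpace ℝ X] (x : ℕ → X) : Prop :=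
  ∀ f : StrongDual ℝ X, Tendsto (fun n => f (x n)) atTop (𝓝 0)

/-- A weak* null sequence of functionals. -/
def IsWeakStarNull {X : Type*} [NormedAddCommGroup X] [NormedSpace ℝ X]
    (f : ℕ → StrongDual ℝ X) : Prop :=
  ∀ x : X, Tendsto (fun n => f n x) atTop (𝓝 0)

/-- The closure of `A` in the weak topology is weakly compact. -/
def IsRelWeaklyCompact {X : Type*} [NormedAddCommGroup X] [NormedSpace ℝ X] (A : Set X) : Prop :=
  IsCompact (closure (toWeakSpace ℝ X '' A))

/-- Schur property: weakly null sequences are norm null. -/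
def HasSchurProperty (X : Type*) [NormedAddCommGroup X] [NormedSpace ℝ X] : Prop :=
  ∀ x : ℕ → X, IsWeaklyNull x → Tendsto (fun n => ‖x n‖) atTop (𝓝 0)

/-- The lattice operations are weakly sequentially continuous: `|x_n| → 0` weakly whenever
`x_n → 0` weakly (since `||x_n| - |x|| ≤ |x_n - x|`, continuity at `0` is continuity everywhere). -/
def HasWeaklySeqContinuousLatticeOps (E : Type*) [NormedAddCommGroup E] [NormedSpace ℝ E]
    [Lattice E] : Prop :=
  ∀ x : ℕ → E, IsWeaklyNull x → IsWeaklyNull fun n => |x n|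

section Sets

variable {E : Type*} [NormedAddCommGroup E] [NormedSpace ℝ E] [Lattice E]

/-- An Lwc set: a bounded set such that every disjoint sequence in its solid hull
`{y | ∃ a ∈ A, |y| ≤ |a|}` is norm null. -/
def IsLwcSet (A : Set E) : Prop :=
  Bornology.IsBounded A ∧
    ∀ x : ℕ → E, IsDisjointSeq x → (∀ n, x n ∈ LatticeOrderedAddCommGroup.solidClosure A) →
      Tendsto (fun n => ‖x n‖) atTop (𝓝 0)

/-- An almost limited set: a bounded set on which every disjoint weak* null sequence of the dual
is uniformly null. -/
def IsAlmostLimitedSet [IsOrderedAddMonoid E] [HasSolidNorm E] (A : Set E) : Prop :=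
  Bornology.IsBounded A ∧
    ∀ f : ℕ → StrongDual ℝ E, IsDisjointSeq f → IsWeakStarNull f →
      TendstoUniformlyOn (fun n x => f n x) (fun _ => 0) atTop A

/-- An almost order bounded set: a bounded set contained, for each `ε > 0`, in
`[a, b] + ε B` for some `a`, `b`, where `B` is the closed unit ball. -/
def IsAlmostOrderBounded (A : Set E) : Prop :=
  Bornology.IsBounded A ∧
    ∀ ε > (0 : ℝ), ∃ a b : E, A ⊆ Icc a b + ε • Metric.closedBall (0 : E) 1

end Sets

/-! ## Classes of operators -/

section Operators

variable {E F X Y : Type*}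
  [NormedAddCommGroup X] [NormedSpace ℝ X] [NormedAddCommGroup Y] [NormedSpace ℝ Y]
  [NormedAddCommGroup E] [NormedSpace ℝ E] [Lattice E]
  [NormedAddCommGroup F] [NormedSpace ℝ F] [Lattice F]

/-- A positive operator. -/
def IsPositiveOp (T : E →L[ℝ] F) : Prop := ∀ x, 0 ≤ x → 0 ≤ T x

/-- M-weakly compact operators (Mwc). -/
def IsMwc (T : E →L[ℝ] Y) : Prop :=
  ∀ x : ℕ → E, IsDisjointSeq x → Bornology.IsBounded (range x) →
    Tendsto (fun n => ‖T (x n)‖) atTop (𝓝 0)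

/-- Almost L-weakly compact operators (aLwc). -/
def IsAlmostLwc (T : X →L[ℝ] F) : Prop :=
  ∀ A : Set X, IsRelWeaklyCompact A → IsLwcSet (T '' A)

/-- Order L-weakly compact operators (oLwc). -/
def IsOrderLwc (T : E →L[ℝ] F) : Prop :=
  ∀ A : Set E, (∃ a b, A ⊆ Icc a b) → IsLwcSet (T '' A)

/-- Dunford-Pettis operators (DP). -/
def IsDunfordPettis (T : X →L[ℝ] Y) : Prop :=
  ∀ x : ℕ → X, IsWeaklyNull x → Tendsto (fun n => ‖T (x n)‖) atTop (𝓝 0)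

/-- Almost limited operators (aLim). -/
def IsAlmostLimited [IsOrderedAddMonoid F] [HasSolidNorm F] (T : X →L[ℝ] F) : Prop :=
  IsAlmostLimitedSet (T '' Metric.closedBall (0 : X) 1)

/-- Semi-compact operators (semi-K). -/
def IsSemiCompact (T : X →L[ℝ] F) : Prop :=
  ∀ A : Set X, Bornology.IsBounded A → IsAlmostOrderBounded (T '' A)

end Operators

end BanachLattice

end

noncomputable section

namespace BanachLattice

/-! ## Disjointness in lattice-ordered groups -/

section LatticeOrderedGroup

variable {G : Type*} [AddCommGroup G] [Lattice G] [IsOrderedAddMonoid G]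

/-! Order continuity of the norm of `E*` makes bounded disjoint sequences in `E` weakly null
(`IsDisjointSeq.isWeaklyNull`), which settles the Dunford–Pettis case at once. On the side of `F`,
an Lwc set lies in an order interval up to `ε` (`IsLwcSet.exists_norm_posPart_le`), and positive,
order bounded, weakly null sequences are norm null. Hence positive weakly null sequences in the
solid hull of an Lwc set are norm null (`IsLwcSet.tendsto_of_isWeaklyNull`).

For positive `T` this applies to `T |x n|`, which dominates `|T (x n)|`; if the lattice operations
are weakly sequentially continuous, it applies to `|T (x n)|` itself. A positive almost limited
operator fits the same scheme because it maps the unit ball to an Lwc set, as tested by functionals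
restricted to disjoint bands. Under the Schur property all bounded sets of `E` are Lwc, and
semi-compactness follows by truncating first in `E`, then in `F`. -/

lemma add_inf_le_inf_add_inf {x y u : G} (hx : 0 ≤ x) (hy : 0 ≤ y) (hu : 0 ≤ u) :
    (x + y) ⊓ u ≤ x ⊓ u + y ⊓ u := by
  rw [inf_add, add_inf, add_inf]
  refine le_inf (le_inf inf_le_left ?_) (le_inf ?_ ?_)
  · exact inf_le_right.trans (le_add_of_nonneg_left hx)
  · exact inf_le_right.trans (le_add_of_nonneg_right hy)
  · exact inf_le_right.trans (le_add_of_nonneg_right hu)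

lemma inf_eq_zero_of_le {a a' b b' : G} (ha : 0 ≤ a') (hb : 0 ≤ b') (haa : a' ≤ a)
    (hbb : b' ≤ b) (h : a ⊓ b = 0) : a' ⊓ b' = 0 :=
  le_antisymm ((inf_le_inf haa hbb).trans h.le) (le_inf ha hb)

lemma add_inf_eq_zero {x y u : G} (hx : 0 ≤ x) (hy : 0 ≤ y) (hu : 0 ≤ u) (h₁ : x ⊓ u = 0)
    (h₂ : y ⊓ u = 0) : (x + y) ⊓ u = 0 :=
  le_antisymm ((add_inf_le_inf_add_inf hx hy hu).trans (by rw [h₁, h₂, add_zero]))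
    (le_inf (add_nonneg hx hy) hu)

lemma sum_inf_eq_zero {ι : Type*} (s : Finset ι) {x : ι → G} {u : G} (hx : ∀ i ∈ s, 0 ≤ x i)
    (hu : 0 ≤ u) (h : ∀ i ∈ s, x i ⊓ u = 0) : (∑ i ∈ s, x i) ⊓ u = 0 := by
  induction s using Finset.cons_induction with
  | empty => simpa using hu
  | cons a s ha ih =>
    rw [Finset.sum_cons]
    exact add_inf_eq_zero (hx a (by simp)) (Finset.sum_nonneg fun i hi => hx i (by simp [hi])) hu
      (h a (by simp)) (ih (fun i hi => hx i (by simp [hi])) fun i hi => h i (by simp [hi]))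

lemma nsmul_inf_eq_zero {x u : G} (hx : 0 ≤ x) (hu : 0 ≤ u) (h : x ⊓ u = 0) (k : ℕ) :
    (k • x) ⊓ u = 0 := by
  simpa using sum_inf_eq_zero (Finset.range k) (x := fun _ => x) (fun _ _ => hx) hu fun _ _ => h

/-- For disjoint positive elements the sum is the supremum, by `a ⊓ b + a ⊔ b = a + b`. -/
lemma sum_le_of_disjoint {z : ℕ → G} {x : G} (h0 : ∀ n, 0 ≤ z n) (hzx : ∀ n, z n ≤ x)
    (hd : ∀ m n, m ≠ n → z m ⊓ z n = 0) (N : ℕ) : ∑ n ∈ Finset.range N, z n ≤ x := by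
  induction N with
  | zero => simpa using (h0 0).trans (hzx 0)
  | succ N ih =>
    have h := sum_inf_eq_zero (Finset.range N) (u := z N) (fun i _ => h0 i) (h0 N)
      fun i hi => hd i N (Finset.mem_range.1 hi).ne
    rw [Finset.sum_range_succ, ← inf_add_sup, h, zero_add]
    exact sup_le ih (hzx N)

lemma posPart_inf_posPart_eq_zero {a b : G} (h : a + b ≤ 0) : a⁺ ⊓ b⁺ = 0 := by
  refine inf_eq_zero_of_le (posPart_nonneg a) (posPart_nonneg b) le_rfl ?_
    (posPart_inf_negPart_eq_zero a)
  rw [negPart_def]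
  exact sup_le_sup_right (le_neg_iff_add_nonpos_left.2 h) 0

/-- For `0 ≤ u`, `(a ⊓ u) ⊔ (-u)` truncates `a` to `[-u, u]`; the error is controlled by the excess
of `|a|` over `u`. -/
lemma abs_sub_truncate_le (a u : G) : |a - (a ⊓ u) ⊔ (-u)| ≤ (|a| - u)⁺ := by
  refine abs_le'.2 ⟨?_, ?_⟩
  · calc a - (a ⊓ u) ⊔ (-u) ≤ a - a ⊓ u := sub_le_sub_left le_sup_left a
      _ = (a - u)⁺ := by rw [inf_eq_sub_posPart_sub, sub_sub_cancel]
      _ ≤ (|a| - u)⁺ := posPart_mono (sub_le_sub_right (le_abs_self a) u)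
  · rw [neg_sub, sub_le_iff_le_add]
    refine sup_le ?_ ?_
    · exact inf_le_left.trans (le_add_of_nonneg_left (posPart_nonneg _))
    · rw [← sub_le_iff_le_add]
      refine le_trans ?_ (le_posPart _)
      rw [sub_eq_add_neg, add_comm, ← sub_eq_add_neg]
      exact sub_le_sub_right (neg_le_abs a) u

lemma IsDisjointSeq.abs {x : ℕ → G} (hx : IsDisjointSeq x) : IsDisjointSeq fun n => |x n| :=
  fun m n h => by simpa only [abs_abs] using hx m n h

end LatticeOrderedGroup

/-! ## Order continuous norms -/

section OrderContinuousNorm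

variable {E : Type*} [NormedAddCommGroup E] [NormedSpace ℝ E] [Lattice E]
  [IsOrderedAddMonoid E] [HasSolidNorm E]

lemma norm_le_of_nonneg_of_le {x y : E} (hx : 0 ≤ x) (hxy : x ≤ y) : ‖x‖ ≤ ‖y‖ :=
  norm_le_of_mem_Icc ⟨hx, hxy⟩

lemma nonpos_of_forall_nsmul_le [IsOrderedModule ℝ E] {w u : E} (h : ∀ k : ℕ, k • w ≤ u) :
    w ≤ 0 := by
  have h1 : Tendsto (fun k : ℕ => ((k : ℝ) + 1)⁻¹ • u) atTop (𝓝 ((0 : ℝ) • u)) := by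
    refine Tendsto.smul_const ?_ u
    simpa using tendsto_one_div_add_atTop_nhds_zero_nat (𝕜 := ℝ)
  rw [zero_smul] at h1
  refine ge_of_tendsto' h1 fun k => ?_
  have h2 : ((k : ℝ) + 1)⁻¹ • ((k + 1 : ℕ) • w) ≤ ((k : ℝ) + 1)⁻¹ • u :=
    smul_le_smul_of_nonneg_left (h (k + 1)) (by positivity)
  rwa [← Nat.cast_smul_eq_nsmul ℝ, smul_smul, Nat.cast_add, Nat.cast_one,
    inv_mul_cancel₀ (by positivity), one_smul] at h2

/-- A supremum of `s` need not be known to exist, so the differences `v - s N` are taken over all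
upper bounds `v`. They are directed downward, and their infimum is `0` by the Archimedean property.
-/
lemma HasOrderContinuousNorm.exists_norm_sub_lt [IsOrderedModule ℝ E]
    (hE : HasOrderContinuousNorm E) {s : ℕ → E} (hs : Monotone s) {u : E} (hu : ∀ n, s n ≤ u)
    {ε : ℝ} (hε : 0 < ε) : ∃ N, ∀ m ≥ N, ‖s m - s N‖ < ε := by
  obtain ⟨_, ⟨v, hv, N, rfl⟩, hN⟩ := hE
    {d | ∃ v, (∀ n, s n ≤ v) ∧ ∃ N, d = v - s N} ⟨u - s 0, u, hu, 0, rfl⟩ (by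
      rintro _ ⟨v, hv, N, rfl⟩ _ ⟨w, hw, M, rfl⟩
      refine ⟨v ⊓ w - s (max N M), ⟨v ⊓ w, fun n => le_inf (hv n) (hw n), _, rfl⟩, ?_, ?_⟩
      · exact sub_le_sub inf_le_left (hs (le_max_left N M))
      · exact sub_le_sub inf_le_right (hs (le_max_right N M))) (by
      refine ⟨?_, fun w hw => ?_⟩
      · rintro _ ⟨v, hv, N, rfl⟩
        exact sub_nonneg.2 (hv N)
      -- Subtracting a lower bound `w` of the differences from an upper bound of `s` gives another
      -- upper bound, so this can be repeated.
      · have key : ∀ k : ℕ, ∀ n, s n ≤ u - k • w := by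
          intro k
          induction k with
          | zero => simpa using hu
          | succ k ih =>
            intro n
            have := hw ⟨u - k • w, ih, n, rfl⟩
            rw [succ_nsmul, ← sub_sub]
            exact le_sub_comm.1 this
        exact nonpos_of_forall_nsmul_le (u := u - s 0) fun k => le_sub_comm.1 (key k 0)) ε hε
  exact ⟨N, fun m hm => (norm_le_of_nonneg_of_le (sub_nonneg.2 (hs hm))
    (sub_le_sub_right (hv m) _)).trans_lt hN⟩

lemma HasOrderContinuousNorm.cauchySeq [IsOrderedModule ℝ E]
    (hE : HasOrderContinuousNorm E) {s : ℕ → E} (hs : Monotone s) {u : E} (hu : ∀ n, s n ≤ u) :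
    CauchySeq s := by
  refine Metric.cauchySeq_iff'.2 fun ε hε => ?_
  simpa only [dist_eq_norm] using hE.exists_norm_sub_lt hs hu hε

lemma HasOrderContinuousNorm.tendsto_succ_sub [IsOrderedModule ℝ E]
    (hE : HasOrderContinuousNorm E) {s : ℕ → E} (hs : Monotone s) {u : E} (hu : ∀ n, s n ≤ u) :
    Tendsto (fun n => ‖s (n + 1) - s n‖) atTop (𝓝 0) := by
  have h := hE.cauchySeq hs hu
  refine ((cauchySeq_iff_tendsto_dist_atTop_0.1 h).comp
    (prod_atTop_atTop_eq (α := ℕ) (β := ℕ) ▸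
      (tendsto_add_atTop_nat 1).prodMk (tendsto_id (x := atTop)))).congr fun n => ?_
  exact dist_eq_norm (s (n + 1)) (s n)

/-- The partial sums increase and stay below `x`, so they are Cauchy, and their increments are the
`z n`. -/
lemma HasOrderContinuousNorm.tendsto_of_disjoint [IsOrderedModule ℝ E]
    (hE : HasOrderContinuousNorm E) {z : ℕ → E} (h0 : ∀ n, 0 ≤ z n) {x : E} (hzx : ∀ n, z n ≤ x)
    (hd : ∀ m n, m ≠ n → z m ⊓ z n = 0) : Tendsto (fun n => ‖z n‖) atTop (𝓝 0) := by
  have hs : Monotone fun N => ∑ n ∈ Finset.range N, z n :=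
    monotone_nat_of_le_succ fun N => by
      simpa only [Finset.sum_range_succ] using le_add_of_nonneg_right (h0 N)
  simpa [Finset.sum_range_succ] using hE.tendsto_succ_sub hs (sum_le_of_disjoint h0 hzx hd)

end OrderContinuousNorm

/-! ## Functionals -/

section Functionals

variable {E : Type*} [NormedAddCommGroup E] [NormedSpace ℝ E] [Lattice E]
  [IsOrderedAddMonoid E] [HasSolidNorm E]

lemma map_mono_of_nonneg {g : StrongDual ℝ E} (hg : 0 ≤ g) {x y : E} (h : x ≤ y) :
    g x ≤ g y := by
  have := hg (y - x) (sub_nonneg.2 h)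
  rw [map_sub] at this
  simpa using this

lemma map_nonneg_of_nonneg {g : StrongDual ℝ E} (hg : 0 ≤ g) {x : E} (h : 0 ≤ x) :
    0 ≤ g x := by
  simpa using map_mono_of_nonneg hg h

/-- A positive functional of norm at most one that attains the norm at a given positive vector. -/
lemma exists_nonneg_functional {z : E} (hz : 0 ≤ z) :
    ∃ g : StrongDual ℝ E, 0 ≤ g ∧ ‖g‖ ≤ 1 ∧ g z = ‖z‖ := by
  obtain ⟨f, hf, hfz⟩ := exists_dual_vector'' ℝ z
  refine ⟨|f|, abs_nonneg f, (norm_abs_eq_norm f).trans_le hf, le_antisymm ?_ ?_⟩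
  · refine (le_abs_self _).trans ((|f|.le_opNorm z).trans ?_)
    rw [norm_abs_eq_norm]
    exact mul_le_of_le_one_left (norm_nonneg z) hf
  · have := le_abs_self f z hz
    rw [hfz] at this
    simpa using this

/-- An additive function on the positive cone dominated by a functional extends to a functional. -/
lemma exists_functional_of_additive (φ : E → ℝ)
    (hadd : ∀ x y, 0 ≤ x → 0 ≤ y → φ (x + y) = φ x + φ y) (h0 : ∀ x, 0 ≤ x → 0 ≤ φ x)
    (g : StrongDual ℝ E) (hle : ∀ x, 0 ≤ x → φ x ≤ g x) :
    ∃ h : StrongDual ℝ E, ∀ x, 0 ≤ x → h x = φ x := by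
  have hzero : φ 0 = 0 := by simpa using hadd 0 0 le_rfl le_rfl
  let H : E →+ ℝ := AddMonoidHom.mk' (fun x => φ x⁺ - φ x⁻) fun x y => by
    have h : (x + y)⁺ + (x⁻ + y⁻) = (x⁺ + y⁺) + (x + y)⁻ := by
      rw [← sub_eq_sub_iff_add_eq_add, posPart_sub_negPart, add_sub_add_comm,
        posPart_sub_negPart, posPart_sub_negPart]
    have := congrArg φ h
    have hp := fun z : E => posPart_nonneg z
    have hn := fun z : E => negPart_nonneg z
    rw [hadd _ _ (hp _) (add_nonneg (hn _) (hn _)), hadd _ _ (hn _) (hn _),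
      hadd _ _ (add_nonneg (hp _) (hp _)) (hn _), hadd _ _ (hp _) (hp _)] at this
    linarith
  have hb : ∀ x, ‖H x‖ ≤ ‖g‖ * ‖x‖ := fun x => by
    have key : ∀ z : E, 0 ≤ z → z ≤ |x| → φ z ≤ ‖g‖ * ‖x‖ := fun z hz hzx =>
      (hle z hz).trans ((apply_le_of_mem_Icc g ⟨hz, hzx⟩).trans_eq (by rw [norm_abs_eq_norm]))
    have hp := key x⁺ (posPart_nonneg x) (sup_le (le_abs_self x) (abs_nonneg x))
    have hn := key x⁻ (negPart_nonneg x) (sup_le (neg_le_abs x) (abs_nonneg x))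
    have hp0 := h0 _ (posPart_nonneg x)
    have hn0 := h0 _ (negPart_nonneg x)
    rw [Real.norm_eq_abs, abs_le]
    change _ ≤ φ x⁺ - φ x⁻ ∧ φ x⁺ - φ x⁻ ≤ _
    constructor <;> linarith
  refine ⟨H.toRealLinearMap (AddMonoidHomClass.continuous_of_bound H ‖g‖ hb), fun x hx => ?_⟩
  change φ x⁺ - φ x⁻ = φ x
  rw [posPart_of_nonneg hx, negPart_of_nonneg hx, hzero, sub_zero]

/-- The restriction of a positive functional to the band generated by a positive vector. -/
lemma exists_band_restriction {g : StrongDual ℝ E} (hg : 0 ≤ g) {u : E} (hu : 0 ≤ u) :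
    ∃ h : StrongDual ℝ E, 0 ≤ h ∧ h ≤ g ∧
      ∀ x, 0 ≤ x → Tendsto (fun k : ℕ => g (x ⊓ k • u)) atTop (𝓝 (h x)) := by
  have hmono : ∀ x, Monotone fun k : ℕ => g (x ⊓ k • u) := fun x k l hkl =>
    map_mono_of_nonneg hg (inf_le_inf_left x (nsmul_le_nsmul_left hu hkl))
  have hbdd : ∀ x, BddAbove (range fun k : ℕ => g (x ⊓ k • u)) := fun x =>
    ⟨g x, by rintro _ ⟨k, rfl⟩; exact map_mono_of_nonneg hg inf_le_left⟩
  have hlim : ∀ x, Tendsto (fun k : ℕ => g (x ⊓ k • u)) atTop (𝓝 (⨆ k : ℕ, g (x ⊓ k • u))) :=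
    fun x => tendsto_atTop_ciSup (hmono x) (hbdd x)
  have hnn : ∀ x, 0 ≤ x → 0 ≤ ⨆ k : ℕ, g (x ⊓ k • u) := fun x hx =>
    ge_of_tendsto' (hlim x) fun k => map_nonneg_of_nonneg hg (le_inf hx (nsmul_nonneg hu k))
  have hle : ∀ x, 0 ≤ x → ⨆ k : ℕ, g (x ⊓ k • u) ≤ g x := fun x hx =>
    le_of_tendsto' (hlim x) fun k => map_mono_of_nonneg hg inf_le_left
  obtain ⟨h, hh⟩ := exists_functional_of_additive (fun x => ⨆ k : ℕ, g (x ⊓ k • u)) (by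
    intro x y hx hy
    refine le_antisymm ?_ ?_
    · refine le_of_tendsto_of_tendsto' (hlim (x + y)) ((hlim x).add (hlim y)) fun k => ?_
      rw [← map_add]
      exact map_mono_of_nonneg hg (add_inf_le_inf_add_inf hx hy (nsmul_nonneg hu k))
    -- Two truncations at `k • u` add up to one at `(k + k) • u`, so the limit for `x + y` is taken
    -- along `k + k`.
    · refine le_of_tendsto_of_tendsto' ((hlim x).add (hlim y))
        ((hlim (x + y)).comp (tendsto_atTop_mono (fun k => Nat.le_add_right k k) tendsto_id)) fun k => ?_
      rw [← map_add]
      refine map_mono_of_nonneg hg (le_inf (add_le_add inf_le_left inf_le_left) ?_)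
      simp only [add_nsmul]
      exact add_le_add inf_le_right inf_le_right) hnn g hle
  refine ⟨h, fun x hx => ?_, fun x hx => ?_, fun x hx => ?_⟩
  · rw [hh x hx]
    exact hnn x hx
  · rw [hh x hx]
    exact hle x hx
  · rw [hh x hx]
    exact hlim x

/-- If the dual norm is order continuous, bounded disjoint sequences are weakly null. -/
theorem IsDisjointSeq.isWeaklyNull (hE : HasOrderContinuousNorm (StrongDual ℝ E)) {x : ℕ → E}
    (hx : IsDisjointSeq x) (hb : Bornology.IsBounded (range x)) : IsWeaklyNull x := by
  intro f
  obtain ⟨M, hM⟩ := hb.exists_norm_le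
  have hs0 : ∀ N, 0 ≤ ∑ n ∈ Finset.range N, |x n| := fun N =>
    Finset.sum_nonneg fun n _ => abs_nonneg _
  have hf : 0 ≤ |f| := abs_nonneg f
  -- `φ N` restricts `|f|` to the band of `x 0, …, x (N - 1)`. It vanishes at `|x N|`, while `φ (N +
  -- 1)` recovers `|f|` there; the increments are norm null since `φ` increases below `|f|`.
  choose φ hφ0 hφf hφ using fun N => exists_band_restriction hf (hs0 N)
  have hmono : Monotone φ := monotone_nat_of_le_succ fun N y hy =>
    le_of_tendsto_of_tendsto' (hφ N y hy) (hφ (N + 1) y hy) fun k =>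
      map_mono_of_nonneg hf (inf_le_inf_left y (nsmul_le_nsmul_right (by
        rw [Finset.sum_range_succ]
        exact le_add_of_nonneg_right (abs_nonneg _)) k))
  have h1 : ∀ N, φ N |x N| = 0 := fun N => by
    refine tendsto_nhds_unique (hφ N _ (abs_nonneg _)) ?_
    have : ∀ k : ℕ, |x N| ⊓ k • ∑ n ∈ Finset.range N, |x n| = 0 := fun k => by
      rw [inf_comm]
      exact nsmul_inf_eq_zero (hs0 N) (abs_nonneg _)
        (sum_inf_eq_zero _ (fun _ _ => abs_nonneg _) (abs_nonneg _)
          fun i hi => hx i N (Finset.mem_range.1 hi).ne) k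
    simp [this]
  have h2 : ∀ N, |f| |x N| ≤ φ (N + 1) |x N| := fun N => by
    refine ge_of_tendsto (hφ (N + 1) _ (abs_nonneg _)) ?_
    filter_upwards [eventually_ge_atTop 1] with k hk
    refine map_mono_of_nonneg hf (le_inf le_rfl ?_)
    calc |x N| ≤ ∑ n ∈ Finset.range (N + 1), |x n| := by
          rw [Finset.sum_range_succ]
          exact le_add_of_nonneg_left (hs0 N)
      _ = 1 • ∑ n ∈ Finset.range (N + 1), |x n| := (one_nsmul _).symm
      _ ≤ _ := nsmul_le_nsmul_left (hs0 (N + 1)) hk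
  refine squeeze_zero_norm (a := fun N => ‖φ (N + 1) - φ N‖ * M) (fun N => ?_) ?_
  · calc ‖f (x N)‖ ≤ |f| |x N| := abs_apply_le_abs f (x N)
      _ ≤ (φ (N + 1) - φ N) |x N| := by
        rw [sub_apply, h1, sub_zero]
        exact h2 N
      _ ≤ ‖φ (N + 1) - φ N‖ * ‖|x N|‖ := (le_abs_self _).trans ((φ (N + 1) - φ N).le_opNorm _)
      _ ≤ ‖φ (N + 1) - φ N‖ * M := by
        rw [norm_abs_eq_norm]
        exact mul_le_mul_of_nonneg_left (hM _ ⟨N, rfl⟩) (norm_nonneg _)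
  · simpa using (hE.tendsto_succ_sub hmono hφf).mul_const M

end Functionals

/-! ## Lwc sets and weakly null sequences -/

section LwcSets

variable {E : Type*} [NormedAddCommGroup E] [NormedSpace ℝ E] [Lattice E]
  [IsOrderedAddMonoid E]

lemma posPart_le_posPart_smul [IsOrderedModule ℝ E] (x : E) {t : ℝ} (ht : 1 ≤ t) : x⁺ ≤ (t • x)⁺ := by
  have ht0 : 0 < t := one_pos.trans_le ht
  refine sup_le ?_ (posPart_nonneg _)
  calc x = t⁻¹ • (t • x) := by rw [smul_smul, inv_mul_cancel₀ ht0.ne', one_smul]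
    _ ≤ t⁻¹ • (t • x)⁺ := smul_le_smul_of_nonneg_left (le_posPart _) (by positivity)
    _ ≤ (1 : ℝ) • (t • x)⁺ :=
      smul_le_smul_of_nonneg_right (inv_le_one_of_one_le₀ ht) (posPart_nonneg _)
    _ = _ := one_smul _ _

variable [HasSolidNorm E]

lemma IsWeaklyNull.of_le {y z : ℕ → E} (hy : IsWeaklyNull y) (h0 : ∀ n, 0 ≤ z n)
    (hzy : ∀ n, z n ≤ y n) : IsWeaklyNull z := fun f =>
  squeeze_zero_norm (fun n => (abs_apply_le_abs f (z n)).trans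
    ((map_mono_of_nonneg (abs_nonneg f) (by rw [abs_of_nonneg (h0 n)]; exact hzy n)))) (hy |f|)

variable [CompleteSpace E] [IsOrderedModule ℝ E]

/-- A bounded sequence, each term of which exceeds in norm large multiples of its predecessors,
dominates a disjoint sequence that is not norm null. -/
lemma exists_disjoint_le_abs {a s : ℕ → E} (ha : Bornology.IsBounded (range a))
    (hs : ∀ i k, i < k → |a i| ≤ s k) (hs0 : ∀ k, 0 ≤ s k) :
    ∃ z : ℕ → E, IsDisjointSeq z ∧ (∀ k, |z k| ≤ |a k|) ∧
      Tendsto (fun k => ‖(|a k| - (4 : ℝ) ^ k • s k)⁺ - z k‖) atTop (𝓝 0) := by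
  obtain ⟨M, hM⟩ := ha.exists_norm_le
  have hM' : ∀ k, ‖a k‖ ≤ M := fun k => hM _ ⟨k, rfl⟩
  have hsum : Summable fun j : ℕ => ((1 / 2 : ℝ) ^ j) • |a j| := by
    refine Summable.of_norm_bounded (summable_geometric_two.mul_right M) fun j => ?_
    rw [norm_smul, norm_abs_eq_norm, Real.norm_of_nonneg (by positivity)]
    exact mul_le_mul_of_nonneg_left (hM' j) (by positivity)
  set y := ∑' j : ℕ, ((1 / 2 : ℝ) ^ j) • |a j|
  have hterm : ∀ j : ℕ, 0 ≤ ((1 / 2 : ℝ) ^ j) • |a j| := fun j =>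
    smul_nonneg (by positivity) (abs_nonneg _)
  have hle : ∀ j : ℕ, ((1 / 2 : ℝ) ^ j) • |a j| ≤ y := fun j =>
    hsum.le_tsum j fun i _ => hterm i
  have hy0 : 0 ≤ y := (hterm 0).trans (hle 0)
  -- Subtracting `4 ^ k • s k` separates `z k` from earlier terms, and `(1 / 2) ^ k • y` from later
  -- ones; only the second cut is norm null.
  set z : ℕ → E := fun k => (|a k| - (4 : ℝ) ^ k • s k - (1 / 2 : ℝ) ^ k • y)⁺
  have hz0 : ∀ k, 0 ≤ z k := fun k => posPart_nonneg _
  have h4 : ∀ k, 0 ≤ (4 : ℝ) ^ k • s k := fun k => smul_nonneg (by positivity) (hs0 k)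
  have h2 : ∀ k, 0 ≤ (1 / 2 : ℝ) ^ k • y := fun k => smul_nonneg (by positivity) hy0
  have key : ∀ j k, j < k → z j ⊓ z k = 0 := fun j k hjk => by
    have h1 : z j ≤ ((4 : ℝ) ^ k • (|a j| - (1 / 2 : ℝ) ^ j • (1 / 2 : ℝ) ^ k • |a k|))⁺ := by
      refine (posPart_mono ?_).trans (posPart_le_posPart_smul _ (one_le_pow₀ (by norm_num)))
      exact sub_le_sub (sub_le_self _ (h4 j))
        (smul_le_smul_of_nonneg_left (hle k) (by positivity))
    have h3 : z k ≤ (|a k| - (4 : ℝ) ^ k • |a j|)⁺ :=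
      posPart_mono ((sub_le_self _ (h2 k)).trans
        (sub_le_sub_left (smul_le_smul_of_nonneg_left (hs j k hjk) (by positivity)) _))
    refine inf_eq_zero_of_le (hz0 j) (hz0 k) h1 h3 (posPart_inf_posPart_eq_zero ?_)
    -- For `j < k` the product is `2 ^ (k - j)`, which makes the sum of the two elements under the
    -- positive parts nonpositive.
    have h5 : (1 : ℝ) ≤ 4 ^ k * ((1 / 2) ^ j * (1 / 2) ^ k) := by
      calc (1 : ℝ) = 4 ^ k * ((1 / 2) ^ k * (1 / 2) ^ k) := by
            rw [← mul_pow, ← mul_pow]; norm_num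
        _ ≤ _ := by
          gcongr ?_ * (?_ * ?_)
          exact pow_le_pow_of_le_one (by norm_num) (by norm_num) hjk.le
    have h6 := smul_le_smul_of_nonneg_right h5 (abs_nonneg (a k))
    rw [one_smul, ← smul_smul, ← smul_smul] at h6
    rw [smul_sub, sub_add_sub_cancel', sub_nonpos]
    exact h6
  refine ⟨z, fun m n hmn => ?_, fun k => ?_, ?_⟩
  · rw [abs_of_nonneg (hz0 m), abs_of_nonneg (hz0 n)]
    rcases hmn.lt_or_gt with h | h
    · exact key m n h
    · rw [inf_comm]
      exact key n m h
  · rw [abs_of_nonneg (hz0 k)]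
    exact sup_le ((sub_le_self _ (h2 k)).trans (sub_le_self _ (h4 k))) (abs_nonneg _)
  · have h0 : Tendsto (fun k : ℕ => (1 / 2 : ℝ) ^ k * ‖y‖) atTop (𝓝 0) := by
      simpa using (tendsto_pow_atTop_nhds_zero_of_lt_one (r := (1 / 2 : ℝ)) (by norm_num)
        (by norm_num)).mul_const ‖y‖
    refine squeeze_zero (fun _ => norm_nonneg _) (fun k => ?_) h0
    have := (lipschitzWith_posPart (α := E)).dist_le_mul (|a k| - (4 : ℝ) ^ k • s k)
      (|a k| - (4 : ℝ) ^ k • s k - (1 / 2 : ℝ) ^ k • y)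
    rw [dist_eq_norm, dist_eq_norm, sub_sub_cancel, norm_smul,
      Real.norm_of_nonneg (by positivity), NNReal.coe_one, one_mul] at this
    exact this

/-- An Lwc set is contained, up to `ε`, in an order interval. -/
theorem IsLwcSet.exists_norm_posPart_le {A : Set E} (hA : IsLwcSet A) {ε : ℝ} (hε : 0 < ε) :
    ∃ u : E, 0 ≤ u ∧ ∀ a ∈ A, ‖(|a| - u)⁺‖ ≤ ε := by
  by_contra! h
  choose! c hcA hc using h
  -- Feeding `4 ^ k • s k` back into the failing bound picks elements of `A` whose excess over it
  -- stays above `ε`; `s k` sums the moduli of the earlier choices.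
  let s : ℕ → E := fun k => Nat.rec 0 (fun k s => s + |c ((4 : ℝ) ^ k • s)|) k
  have hs_succ : ∀ k, s (k + 1) = s k + |c ((4 : ℝ) ^ k • s k)| := fun k => rfl
  have hmono : Monotone s := monotone_nat_of_le_succ fun k => by
    rw [hs_succ]
    exact le_add_of_nonneg_right (abs_nonneg _)
  have hs0 : ∀ k, 0 ≤ s k := fun k => hmono (Nat.zero_le k)
  have hu : ∀ k, 0 ≤ (4 : ℝ) ^ k • s k := fun k => smul_nonneg (by positivity) (hs0 k)
  obtain ⟨z, hzd, hza, hz⟩ := exists_disjoint_le_abs (a := fun k => c ((4 : ℝ) ^ k • s k)) (s := s)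
    (hA.1.subset (by rintro _ ⟨k, rfl⟩; exact hcA _ (hu k)))
    (fun i k hik => by
      refine le_trans ?_ (hmono (Nat.succ_le_of_lt hik))
      rw [Nat.succ_eq_add_one, hs_succ]
      exact le_add_of_nonneg_left (hs0 i)) hs0
  have hz0 := hA.2 z hzd fun k => ⟨_, hcA _ (hu k), hza k⟩
  have hlim := hz.add hz0
  rw [add_zero] at hlim
  obtain ⟨k, hk⟩ := (hlim.eventually_lt_const hε).exists
  refine (hc _ (hu k)).not_ge (le_trans ?_ hk.le)
  simpa using norm_add_le ((|c ((4 : ℝ) ^ k • s k)| - (4 : ℝ) ^ k • s k)⁺ - z k) (z k)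

/-- Let `W i` be the supremum of the tail `z i, z (i + 1), …`, a norm limit of finite suprema. As
`W` decreases, `W i - W (i + 1)` is norm null, while `g i (W (i + 1))` is at most the sum of the
values of `g i` on later terms. Each contributes at most `ε / 2` to `g i (W i) ≥ g i (z i)`. -/
lemma HasOrderContinuousNorm.exists_norm_lt_of_almost_biorthogonal (hE : HasOrderContinuousNorm E)
    {z : ℕ → E} (h0 : ∀ n, 0 ≤ z n) {u : E} (hu : ∀ n, z n ≤ u) {g : ℕ → StrongDual ℝ E}
    (hg0 : ∀ n, 0 ≤ g n) (hg1 : ∀ n, ‖g n‖ ≤ 1) {ε : ℝ} (hε : 0 < ε)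
    (hg : ∀ i k, i ≤ k → g i (z (k + 1)) ≤ ε * (1 / 2) ^ (k + 2)) : ∃ n, g n (z n) < ε := by
  by_contra! hgz
  have hle : ∀ i m, partialSups (fun j => z (i + j)) m ≤ u := fun i m =>
    partialSups_le _ _ _ fun j _ => hu _
  choose W hW using fun i => cauchySeq_tendsto_of_complete
    (hE.cauchySeq (partialSups_monotone fun j => z (i + j)) (hle i))
  have hpW : ∀ i m, partialSups (fun j => z (i + j)) m ≤ W i := fun i m =>
    (partialSups_monotone _).ge_of_tendsto (hW i) m
  have hzW : ∀ i, z i ≤ W i := fun i => by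
    simpa using hpW i 0
  have hanti : ∀ i, W (i + 1) ≤ W i := fun i => le_of_tendsto' (hW (i + 1)) fun m =>
    partialSups_le _ _ _ fun j _ => by
      have := (le_partialSups (fun j => z (i + j)) (j + 1)).trans (hpW i (j + 1))
      rwa [show i + 1 + j = i + (j + 1) by ring]
  have hdiff := hE.tendsto_succ_sub (s := fun i => u - W i) (u := u)
    (monotone_nat_of_le_succ fun i => sub_le_sub_left (hanti i) u)
    fun i => sub_le_self _ ((h0 i).trans (hzW i))
  obtain ⟨i, hi⟩ := (hdiff.eventually_lt_const (half_pos hε)).exists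
  have hgW : g i (W (i + 1)) ≤ ε / 2 := by
    refine le_of_tendsto' (((g i).continuous.tendsto _).comp (hW (i + 1))) fun m => ?_
    calc g i (partialSups (fun j => z (i + 1 + j)) m)
        ≤ g i (∑ j ∈ Finset.range (m + 1), z (i + 1 + j)) :=
          map_mono_of_nonneg (hg0 i) (partialSups_le _ _ _ fun j hj =>
            Finset.single_le_sum (f := fun j => z (i + 1 + j)) (fun l _ => h0 _)
              (Finset.mem_range.2 (Nat.lt_succ_of_le hj)))
      _ = ∑ j ∈ Finset.range (m + 1), g i (z (i + 1 + j)) := map_sum _ _ _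
      _ ≤ ∑ j ∈ Finset.range (m + 1), ε / 4 * (1 / 2) ^ j := Finset.sum_le_sum fun j _ => by
          have h1 := hg i (i + j) (Nat.le_add_right i j)
          rw [show i + j + 1 = i + 1 + j by ring] at h1
          refine h1.trans ?_
          have h2 : (1 / 2 : ℝ) ^ (i + j + 2) ≤ (1 / 2) ^ (j + 2) :=
            pow_le_pow_of_le_one (by norm_num) (by norm_num) (by omega)
          calc ε * (1 / 2) ^ (i + j + 2) ≤ ε * (1 / 2) ^ (j + 2) :=
                mul_le_mul_of_nonneg_left h2 hε.le
            _ = _ := by ring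
      _ = ε / 4 * ∑ j ∈ Finset.range (m + 1), (1 / 2 : ℝ) ^ j := by rw [Finset.mul_sum]
      _ ≤ ε / 4 * 2 := mul_le_mul_of_nonneg_left (sum_geometric_two_le _) (by positivity)
      _ = ε / 2 := by ring
  have h1 : g i (W i - W (i + 1)) ≤ ‖W i - W (i + 1)‖ :=
    (le_abs_self _).trans (((g i).le_opNorm _).trans
      (mul_le_of_le_one_left (norm_nonneg _) (hg1 i)))
  have h2 := (hgz i).trans (map_mono_of_nonneg (hg0 i) (hzW i))
  rw [sub_sub_sub_cancel_left] at hi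
  rw [map_sub] at h1
  linarith

/-- For an order continuous norm, positive order bounded weakly null sequences are norm null. -/
theorem HasOrderContinuousNorm.tendsto_of_isWeaklyNull (hE : HasOrderContinuousNorm E)
    {z : ℕ → E} (h0 : ∀ n, 0 ≤ z n) {u : E} (hu : ∀ n, z n ≤ u) (hz : IsWeaklyNull z) :
    Tendsto (fun n => ‖z n‖) atTop (𝓝 0) := by
  rw [Metric.tendsto_atTop]
  by_contra! h
  obtain ⟨ε, hε, h⟩ := h
  simp only [dist_zero_right, norm_norm] at h
  choose ψ hψ hzψ using h
  choose g hg0 hg1 hgz using fun n => exists_nonneg_functional (h0 (ψ n))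
  have hψ' : Tendsto ψ atTop atTop := tendsto_atTop_mono hψ tendsto_id
  -- The threshold handles all `g i` with `i ≤ m`, whichever indices were selected, so the recursion
  -- for `φ` needs only the last index.
  have hN : ∀ m, ∃ N, ∀ n ≥ N, ∀ i ∈ Finset.range (m + 1),
      g i (z (ψ n)) ≤ ε * (1 / 2) ^ (m + 2) := fun m => by
    refine eventually_atTop.1 ((Filter.eventually_all_finset _).2 fun i _ => ?_)
    exact (((hz (g i)).comp hψ').eventually_lt_const (by positivity)).mono fun n hn => hn.le
  choose N hN using hN
  let φ : ℕ → ℕ := fun k => Nat.rec 0 (fun _ p => max (N p) (p + 1)) k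
  have hφ_succ : ∀ k, φ (k + 1) = max (N (φ k)) (φ k + 1) := fun k => rfl
  have hφ : StrictMono φ := strictMono_nat_of_lt_succ fun k => by
    rw [hφ_succ]
    exact lt_max_of_lt_right (Nat.lt_succ_self _)
  obtain ⟨n, hn⟩ := hE.exists_norm_lt_of_almost_biorthogonal (z := fun k => z (ψ (φ k)))
    (fun _ => h0 _) (fun _ => hu _) (g := fun k => g (φ k)) (fun _ => hg0 _) (fun _ => hg1 _) hε
    fun i k hik => by
      have h1 := hN (φ k) (φ (k + 1)) (by rw [hφ_succ]; exact le_max_left _ _) (φ i)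
        (Finset.mem_range.2 (Nat.lt_succ_of_le (hφ.monotone hik)))
      refine h1.trans (mul_le_mul_of_nonneg_left ?_ hε.le)
      exact pow_le_pow_of_le_one (by norm_num) (by norm_num) (Nat.add_le_add_right (hφ.id_le k) 2)
  rw [hgz] at hn
  exact hn.not_ge (hzψ _)

/-- For an order continuous norm, positive weakly null sequences in the solid hull of an Lwc set
are norm null. -/
theorem IsLwcSet.tendsto_of_isWeaklyNull (hE : HasOrderContinuousNorm E) {A : Set E}
    (hA : IsLwcSet A) {y : ℕ → E} (h0 : ∀ n, 0 ≤ y n)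
    (hyA : ∀ n, y n ∈ LatticeOrderedAddCommGroup.solidClosure A) (hy : IsWeaklyNull y) :
    Tendsto (fun n => ‖y n‖) atTop (𝓝 0) := by
  refine tendsto_order.2 ⟨fun c hc => .of_forall fun n => hc.trans_le (norm_nonneg _),
    fun ε hε => ?_⟩
  -- In `y n = y n ⊓ u + (y n - u)⁺` the first summand is order bounded and weakly null, the second
  -- uniformly small.
  obtain ⟨u, hu0, hu⟩ := hA.exists_norm_posPart_le (half_pos hε)
  have hn : ∀ n, 0 ≤ y n ⊓ u := fun n => le_inf (h0 n) hu0
  have h1 := hE.tendsto_of_isWeaklyNull hn (fun n => inf_le_right)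
    (hy.of_le hn fun n => inf_le_left)
  filter_upwards [h1.eventually_lt_const (half_pos hε)] with n h2
  obtain ⟨a, ha, hya⟩ := hyA n
  rw [abs_of_nonneg (h0 n)] at hya
  calc ‖y n‖ = ‖y n ⊓ u + (y n - u)⁺‖ := by rw [inf_eq_sub_posPart_sub, sub_add_cancel]
    _ ≤ ‖y n ⊓ u‖ + ‖(y n - u)⁺‖ := norm_add_le _ _
    _ < ε / 2 + ε / 2 := add_lt_add_of_lt_of_le h2 ((norm_le_of_nonneg_of_le (posPart_nonneg _)
        (posPart_mono (sub_le_sub_right hya u))).trans (hu a ha))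
    _ = ε := add_halves ε

end LwcSets

/-! ## Operators -/

section OperatorLemmas

variable {X Y : Type*} [NormedAddCommGroup X] [NormedSpace ℝ X]
  [NormedAddCommGroup Y] [NormedSpace ℝ Y]

lemma IsWeaklyNull.map {x : ℕ → X} (hx : IsWeaklyNull x) (T : X →L[ℝ] Y) :
    IsWeaklyNull fun n => T (x n) := fun f => hx (f.comp T)

/-- A convergent sequence together with its limit is compact, and closed because the weak topology
is Hausdorff. -/
lemma IsWeaklyNull.isRelWeaklyCompact {x : ℕ → X} (hx : IsWeaklyNull x) :
    IsRelWeaklyCompact (range x) := by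
  have h : Tendsto (fun n => toWeakSpace ℝ X (x n)) atTop (𝓝 (toWeakSpace ℝ X 0)) := by
    refine (WeakBilin.isEmbedding (B := (topDualPairing ℝ X).flip) fun x y hxy => ?_)
      |>.tendsto_nhds_iff.2 (tendsto_pi_nhds.2 fun f => ?_)
    · by_contra hne
      obtain ⟨f, hf⟩ := SeparatingDual.exists_separating_of_ne (R := ℝ) hne
      exact hf (DFunLike.congr_fun hxy f)
    · have := hx f
      rw [← map_zero f] at this
      exact this
  have hc := h.isCompact_insert_range
  refine hc.of_isClosed_subset isClosed_closure (closure_minimal ?_ hc.isClosed)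
  rintro _ ⟨_, ⟨n, rfl⟩, rfl⟩
  exact mem_insert_of_mem _ ⟨n, rfl⟩

end OperatorLemmas

lemma isBounded_range_abs {E : Type*} [NormedAddCommGroup E] [Lattice E]
    [IsOrderedAddMonoid E] [HasSolidNorm E] {x : ℕ → E} (hb : Bornology.IsBounded (range x)) :
    Bornology.IsBounded (range fun n => |x n|) := by
  obtain ⟨M, hM⟩ := hb.exists_norm_le
  refine isBounded_iff_forall_norm_le.2 ⟨M, ?_⟩
  rintro _ ⟨n, rfl⟩
  rw [norm_abs_eq_norm]
  exact hM _ ⟨n, rfl⟩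

/-! ### Positive operators and almost limited images of the ball -/

section PositiveOperators

variable {E F : Type*}
  [NormedAddCommGroup E] [NormedSpace ℝ E] [Lattice E] [IsOrderedAddMonoid E]
  [NormedAddCommGroup F] [NormedSpace ℝ F] [Lattice F] [IsOrderedAddMonoid F]

lemma IsPositiveOp.abs_apply_le {T : E →L[ℝ] F} (hT : IsPositiveOp T) (x : E) :
    |T x| ≤ T |x| := by
  refine abs_le'.2 ⟨?_, ?_⟩
  · rw [← sub_nonneg, ← map_sub]
    exact hT _ (sub_nonneg.2 (le_abs_self x))
  · rw [← sub_nonneg, ← map_neg, ← map_sub]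
    exact hT _ (sub_nonneg.2 (neg_le_abs x))

variable [HasSolidNorm E] [HasSolidNorm F]

/-- For `x ≥ 0`, `h n x` is at most `g n (x ⊓ k n • |z n|) + 1 / (n + 1)` for a suitable `k n`.
These truncations are disjoint and lie below `x`, hence are norm null. -/
lemma tendsto_band_restriction [IsOrderedModule ℝ F] (hF : HasOrderContinuousNorm F) {z : ℕ → F} (hz : IsDisjointSeq z)
    {g h : ℕ → StrongDual ℝ F} (hg : ∀ n, ‖g n‖ ≤ 1) (hh : ∀ n, 0 ≤ h n)
    (hlim : ∀ n x, 0 ≤ x → Tendsto (fun k : ℕ => g n (x ⊓ k • |z n|)) atTop (𝓝 (h n x))) :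
    IsWeakStarNull h := by
  have key : ∀ x, 0 ≤ x → Tendsto (fun n => h n x) atTop (𝓝 0) := by
    intro x hx
    have hk : ∀ n, ∃ k : ℕ, h n x < g n (x ⊓ k • |z n|) + 1 / ((n : ℝ) + 1) := fun n => by
      obtain ⟨k, hk⟩ := ((hlim n x hx).eventually_const_lt
        (sub_lt_self (h n x) (Nat.one_div_pos_of_nat (n := n)))).exists
      exact ⟨k, sub_lt_iff_lt_add.1 hk⟩
    choose k hk using hk
    have hk0 : ∀ n, 0 ≤ k n • |z n| := fun n => nsmul_nonneg (abs_nonneg _) _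
    have hn : ∀ n, 0 ≤ x ⊓ k n • |z n| := fun n => le_inf hx (hk0 n)
    have h1 := hF.tendsto_of_disjoint hn (fun n => inf_le_left) fun m n hmn =>
      inf_eq_zero_of_le (hn m) (hn n) inf_le_right inf_le_right
        (nsmul_inf_eq_zero (abs_nonneg _) (hk0 n) (by
          rw [inf_comm]
          exact nsmul_inf_eq_zero (abs_nonneg _) (abs_nonneg _) (hz n m hmn.symm) _) _)
    have h2 := h1.add (tendsto_one_div_add_atTop_nhds_zero_nat (𝕜 := ℝ))
    rw [add_zero] at h2
    refine squeeze_zero (fun n => map_nonneg_of_nonneg (hh n) hx) (fun n => ?_) h2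
    refine (hk n).le.trans (add_le_add_left ?_ _)
    exact (le_abs_self _).trans (((g n).le_opNorm _).trans
      (mul_le_of_le_one_left (norm_nonneg _) (hg n)))
  intro x
  have := (key x⁺ (posPart_nonneg x)).sub (key x⁻ (negPart_nonneg x))
  simpa only [← map_sub, posPart_sub_negPart, sub_zero] using this

/-- Split `x` into `x ⊓ k • |z m|` and the rest: `h n` vanishes on the first piece, and `h m` of the
rest tends to `0` as `k` grows. -/
lemma disjoint_band_restriction {z : ℕ → F} (hz : IsDisjointSeq z)
    {g h : ℕ → StrongDual ℝ F} (hh : ∀ n, 0 ≤ h n)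
    (hlim : ∀ n x, 0 ≤ x → Tendsto (fun k : ℕ => g n (x ⊓ k • |z n|)) atTop (𝓝 (h n x))) :
    IsDisjointSeq h := by
  intro m n hmn
  rw [abs_of_nonneg (hh m), abs_of_nonneg (hh n)]
  refine le_antisymm (fun x hx => ?_) (le_inf (hh m) (hh n))
  set c := h m ⊓ h n
  have hxk : ∀ k : ℕ, 0 ≤ x ⊓ k • |z m| := fun k => le_inf hx (nsmul_nonneg (abs_nonneg _) k)
  have h1 : ∀ k : ℕ, h n (x ⊓ k • |z m|) = 0 := fun k => by
    refine tendsto_nhds_unique (hlim n _ (hxk k)) ?_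
    have : ∀ l : ℕ, (x ⊓ k • |z m|) ⊓ l • |z n| = 0 := fun l =>
      inf_eq_zero_of_le (hxk k) (nsmul_nonneg (abs_nonneg _) l) inf_le_right le_rfl
        (nsmul_inf_eq_zero (abs_nonneg _) (nsmul_nonneg (abs_nonneg _) l) (by
          rw [inf_comm]
          exact nsmul_inf_eq_zero (abs_nonneg _) (abs_nonneg _) (hz n m hmn.symm) l) k)
    simp [this]
  have h2 : ∀ k : ℕ, g m (x ⊓ k • |z m|) ≤ h m (x ⊓ k • |z m|) := fun k => by
    refine ge_of_tendsto (hlim m _ (hxk k)) ?_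
    filter_upwards [eventually_ge_atTop k] with l hl
    rw [inf_assoc, inf_eq_left.2 (nsmul_le_nsmul_left (abs_nonneg (z m)) hl)]
  have h3 : ∀ k : ℕ, c x ≤ h m x - g m (x ⊓ k • |z m|) := fun k => by
    have h4 : c (x ⊓ k • |z m|) ≤ 0 :=
      ((inf_le_right : c ≤ h n) _ (hxk k)).trans (h1 k).le
    have h5 := (inf_le_left : c ≤ h m) (x - x ⊓ k • |z m|) (sub_nonneg.2 inf_le_left)
    rw [map_sub, map_sub] at h5
    linarith [h2 k]
  have h4 := ge_of_tendsto' (tendsto_const_nhds.sub (hlim m x hx)) h3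
  simpa using h4

/-- A positive almost limited operator into a Banach lattice with order continuous norm maps the
unit ball to an Lwc set. -/
theorem IsAlmostLimited.isLwcSet [IsOrderedModule ℝ F] (hF : HasOrderContinuousNorm F) {T : E →L[ℝ] F}
    (hpos : IsPositiveOp T) (hT : IsAlmostLimited T) :
    IsLwcSet (T '' Metric.closedBall (0 : E) 1) := by
  refine ⟨hT.1, fun z hz hzA => ?_⟩
  choose g hg0 hg1 hgz using fun n => exists_nonneg_functional (abs_nonneg (z n))
  choose h hh0 hhg hlim using fun n => exists_band_restriction (hg0 n) (abs_nonneg (z n))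
  have hunif := hT.2 h (disjoint_band_restriction hz hh0 hlim)
    (tendsto_band_restriction hF hz hg1 hh0 hlim)
  refine tendsto_order.2 ⟨fun c hc => .of_forall fun n => hc.trans_le (norm_nonneg _),
    fun ε hε => ?_⟩
  filter_upwards [Metric.tendstoUniformlyOn_iff.1 hunif ε hε] with n hn
  obtain ⟨_, ⟨b, hb, rfl⟩, hzb⟩ := hzA n
  -- Replacing `b` by `|b|` stays in the ball, and by positivity `T |b|` dominates `|z n|`.
  have h1 := hn (T |b|) ⟨|b|, by simpa [norm_abs_eq_norm] using hb, rfl⟩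
  rw [dist_zero_left, Real.norm_eq_abs] at h1
  have h2 : g n |z n| ≤ h n |z n| := by
    refine ge_of_tendsto (hlim n _ (abs_nonneg _)) ?_
    filter_upwards [eventually_ge_atTop 1] with k hk
    refine map_mono_of_nonneg (hg0 n) (le_inf le_rfl ?_)
    simpa using nsmul_le_nsmul_left (abs_nonneg (z n)) hk
  calc ‖z n‖ = g n |z n| := by rw [hgz, norm_abs_eq_norm]
    _ ≤ h n |z n| := h2
    _ ≤ h n (T |b|) := map_mono_of_nonneg (hh0 n) (hzb.trans (hpos.abs_apply_le b))
    _ ≤ |h n (T |b|)| := le_abs_self _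
    _ < ε := h1

end PositiveOperators

/-! ### M-weak compactness and semi-compactness -/

section MainResults

variable {E F : Type*}
  [NormedAddCommGroup E] [NormedSpace ℝ E] [Lattice E] [IsOrderedAddMonoid E] [HasSolidNorm E]
  [NormedAddCommGroup F] [NormedSpace ℝ F] [CompleteSpace F]
  [Lattice F] [IsOrderedAddMonoid F] [IsOrderedModule ℝ F] [HasSolidNorm F]

/-- The common part of the aLwc and almost limited cases. The scalar `c` allows a bounded sequence
to be scaled into the unit ball. -/
lemma IsPositiveOp.isMwc_of_isLwcSet (hE : HasOrderContinuousNorm (StrongDual ℝ E))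
    (hF : HasOrderContinuousNorm F) {T : E →L[ℝ] F} (hpos : IsPositiveOp T)
    (h : ∀ x : ℕ → E, IsDisjointSeq x → Bornology.IsBounded (range x) →
      ∃ A : Set F, ∃ c : ℝ, 0 < c ∧ IsLwcSet A ∧ ∀ n, c • T (x n) ∈ A) : IsMwc T := by
  intro x hx hb
  have hb' := isBounded_range_abs hb
  obtain ⟨A, c, hc, hA, hxA⟩ := h _ hx.abs hb'
  have h1 : IsWeaklyNull fun n => (c • T) |x n| := (hx.abs.isWeaklyNull hE hb').map (c • T)
  have h2 := (hA.tendsto_of_isWeaklyNull hF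
    (fun n => smul_nonneg hc.le (hpos _ (abs_nonneg (x n))))
    (fun n => ⟨_, hxA n, le_rfl⟩) h1).const_mul c⁻¹
  rw [mul_zero] at h2
  refine squeeze_zero (fun _ => norm_nonneg _) (fun n => ?_) h2
  rw [norm_smul, Real.norm_of_nonneg hc.le, inv_mul_cancel_left₀ hc.ne']
  exact norm_le_norm_of_abs_le_abs ((hpos.abs_apply_le _).trans (le_abs_self _))

theorem IsAlmostLwc.isMwc_of_isPositiveOp (hE : HasOrderContinuousNorm (StrongDual ℝ E))
    (hF : HasOrderContinuousNorm F) {T : E →L[ℝ] F} (hpos : IsPositiveOp T)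
    (hT : IsAlmostLwc T) : IsMwc T :=
  hpos.isMwc_of_isLwcSet hE hF fun x hx hb =>
    ⟨_, 1, one_pos, hT _ (hx.isWeaklyNull hE hb).isRelWeaklyCompact, fun n => by
      rw [one_smul]
      exact mem_image_of_mem T ⟨n, rfl⟩⟩

theorem IsAlmostLimited.isMwc_of_isPositiveOp (hE : HasOrderContinuousNorm (StrongDual ℝ E))
    (hF : HasOrderContinuousNorm F) {T : E →L[ℝ] F} (hpos : IsPositiveOp T)
    (hT : IsAlmostLimited T) : IsMwc T := by
  refine hpos.isMwc_of_isLwcSet hE hF fun x _ hb => ?_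
  obtain ⟨M, hM0, hM⟩ := hb.exists_pos_norm_le
  refine ⟨_, M⁻¹, inv_pos.2 hM0, hT.isLwcSet hF hpos, fun n => ⟨M⁻¹ • x n, ?_, map_smul _ _ _⟩⟩
  rw [mem_closedBall_zero_iff, norm_smul, Real.norm_of_nonneg (inv_pos.2 hM0).le]
  exact (inv_mul_le_one₀ hM0).2 (hM _ ⟨n, rfl⟩)

theorem IsAlmostLwc.isMwc (hE : HasOrderContinuousNorm (StrongDual ℝ E))
    (hF : HasOrderContinuousNorm F) (hlat : HasWeaklySeqContinuousLatticeOps F)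
    {T : E →L[ℝ] F} (hT : IsAlmostLwc T) : IsMwc T := by
  intro x hx hb
  have hw := hx.isWeaklyNull hE hb
  simpa only [norm_abs_eq_norm] using
    (hT _ hw.isRelWeaklyCompact).tendsto_of_isWeaklyNull hF (fun n => abs_nonneg (T (x n)))
      (fun n => ⟨_, mem_image_of_mem T ⟨n, rfl⟩, (abs_abs _).le⟩) (hlat _ (hw.map T))

lemma HasSchurProperty.isLwcSet (hE : HasOrderContinuousNorm (StrongDual ℝ E))
    (hS : HasSchurProperty E) {A : Set E} (hA : Bornology.IsBounded A) : IsLwcSet A := by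
  refine ⟨hA, fun x hx hxA => hS x (hx.isWeaklyNull hE ?_)⟩
  obtain ⟨M, hM⟩ := hA.exists_norm_le
  refine isBounded_iff_forall_norm_le.2 ⟨M, ?_⟩
  rintro _ ⟨n, rfl⟩
  obtain ⟨a, ha, hxa⟩ := hxA n
  exact (norm_le_norm_of_abs_le_abs hxa).trans (hM a ha)

theorem IsOrderLwc.isSemiCompact [CompleteSpace E] [IsOrderedModule ℝ E]
    (hE : HasOrderContinuousNorm (StrongDual ℝ E)) (hS : HasSchurProperty E)
    {T : E →L[ℝ] F} (hT : IsOrderLwc T) : IsSemiCompact T := by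
  refine fun A hA => ⟨T.lipschitz.isBounded_image hA, fun ε hε => ?_⟩
  -- The added `1` permits division when `T = 0`.
  have hT0 : 0 < ‖T‖ + 1 := by positivity
  obtain ⟨u, hu0, hu⟩ := (hS.isLwcSet hE hA).exists_norm_posPart_le
    (div_pos (half_pos hε) hT0)
  obtain ⟨v, hv0, hv⟩ := (hT (Icc (-u) u) ⟨_, _, subset_rfl⟩).exists_norm_posPart_le (half_pos hε)
  refine ⟨-v, v, ?_⟩
  rintro _ ⟨a, ha, rfl⟩
  -- `p` truncates `a` to `[-u, u]`, whose image is Lwc, so `T p` is in turn close to its truncation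
  -- `q`.
  set p := (a ⊓ u) ⊔ (-u)
  set q := (T p ⊓ v) ⊔ (-v)
  refine mem_add.2 ⟨q, ⟨le_sup_right, sup_le inf_le_right (neg_le_self hv0)⟩, T a - q, ?_,
    add_sub_cancel _ _⟩
  have h1 : ‖T (a - p)‖ ≤ ε / 2 := by
    refine (T.le_opNorm _).trans ?_
    calc ‖T‖ * ‖a - p‖ ≤ (‖T‖ + 1) * (ε / 2 / (‖T‖ + 1)) :=
          mul_le_mul (le_add_of_nonneg_right zero_le_one) ((norm_le_norm_of_abs_le_abs
            ((abs_sub_truncate_le a u).trans (le_abs_self _))).trans (hu a ha))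
            (norm_nonneg _) hT0.le
      _ = ε / 2 := mul_div_cancel₀ _ hT0.ne'
  have h2 : ‖T p - q‖ ≤ ε / 2 :=
    (norm_le_norm_of_abs_le_abs ((abs_sub_truncate_le (T p) v).trans (le_abs_self _))).trans
      (hv _ ⟨p, ⟨le_sup_right, sup_le inf_le_right (neg_le_self hu0)⟩, rfl⟩)
  rw [smul_unitClosedBall_of_nonneg hε.le, mem_closedBall_zero_iff]
  calc ‖T a - q‖ = ‖T (a - p) + (T p - q)‖ := by rw [map_sub, sub_add_sub_cancel]
    _ ≤ ε / 2 + ε / 2 := (norm_add_le _ _).trans (add_le_add h1 h2)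
    _ = ε := add_halves ε

end MainResults

end BanachLattice

end

open BanachLattice in
theorem mainTheorem12 {E F : Type*}
    [NormedAddCommGroup E] [NormedSpace ℝ E] [CompleteSpace E]
    [Lattice E] [IsOrderedAddMonoid E] [IsOrderedModule ℝ E] [HasSolidNorm E]
    [NormedAddCommGroup F] [NormedSpace ℝ F] [CompleteSpace F]
    [Lattice F] [IsOrderedAddMonoid F] [IsOrderedModule ℝ F] [HasSolidNorm F]
    (hE : HasOrderContinuousNorm (StrongDual ℝ E)) (hF : HasOrderContinuousNorm F) :
    (∀ T : E →L[ℝ] F, IsPositiveOp T → IsAlmostLwc T → IsMwc T) ∧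
    (∀ T : E →L[ℝ] F, IsPositiveOp T → IsDunfordPettis T → IsMwc T) ∧
    (∀ T : E →L[ℝ] F, IsPositiveOp T → IsAlmostLimited T → IsMwc T) ∧
    (HasWeaklySeqContinuousLatticeOps F → ∀ T : E →L[ℝ] F, IsAlmostLwc T → IsMwc T) ∧
    (HasSchurProperty E → ∀ T : E →L[ℝ] F, IsOrderLwc T → IsSemiCompact T) :=
  ⟨fun _ hpos hT => hT.isMwc_of_isPositiveOp hE hF hpos,
    fun _ _ hT x hx hb => hT x (hx.isWeaklyNull hE hb),
    fun _ hpos hT => hT.isMwc_of_isPositiveOp hE hF hpos,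
    fun hlat _ hT => hT.isMwc hE hF hlat,
    fun hS _ hT => hT.isSemiCompact hE hS⟩
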